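/- Conventions. Let $\mu$ be a regular (infinite) cardinal. A poset is $\mu$-directed if each of its subsets of cardinality $<\mu$ has an upper bound. For cardinals $\theta,\mu$ put $\theta^{<\mu}=\sup_{\alpha<\mu}\theta^{\alpha}$ ($\alpha$ ranging over cardinals); a cardinal $\lambda$ is $\mu$-closed if $\theta^{<\mu}<\lambda$ for all $\theta<\lambda$. A $\mu$-ary vocabulary is a set $\tau$ of function and relation symbols, all of arity $<\mu$. An abstract class is a pair $\mathbf K=(K,\le_{\mathbf K})$, where $K$ is a class of structures in a fixed $\mu$-ary vocabulary $\tau$ and $\le_{\mathbf K}$ is a partial order on $K$, both closed under isomorphism, such that $M\le_{\mathbf K}N$ implies that $M$ is a substructure of $N$. Write $UM$ for the universe of $M$. $\mathbf K$ is a $\mu$-AEC if: (1) if $M_0\subseteq M_1\le_{\mathbf K}M_2$ and $M_0\le_{\mathbf K}M_2$, with all three in $K$, then $M_0\le_{\mathbf K}M_1$; (2) if $\langle M_i: i\in I\rangle$ is a system in $\mathbf K$ indexed by a $\mu$-directed poset, with $M_i\le_{\mathbf K}M_j$ for $i\le j$, then $M=\bigcup_i M_i\in K$, $M_i\le_{\mathbf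 K}M$ for all $i$, and $M\le_{\mathbf K}N$ whenever $M_i\le_{\mathbf K}N$ for all $i$; (3) there is a cardinal $\kappa=\kappa^{<\mu}\ge|\tau|+\mu$ such that for all $M\in K$ and $A\subseteq UM$ there is $M_0\le_{\mathbf K}M$ with $A\subseteq UM_0$ and $|UM_0|\le|A|^{<\mu}+\kappa$. The least such $\kappa$ is denoted $\mathrm{LS}(\mathbf K)$. $\mathbf K$ is regarded as a category whose morphisms $M\to N$ are the maps $f$ that are isomorphisms of $M$ onto a substructure $f[M]$ with $f[M]\le_{\mathbf K}N$. In a category, an object $M$ is $\theta$-presentable ($\theta$ regular) if $\mathrm{Hom}(M,-)$ preserves $\theta$-directed colimits; it is $(<\lambda)$-presentable if it is $\theta$-presentable for some regular $\theta<\lambda+\aleph_1$; its presentability rank is the least regular $\theta$ for which it is $\theta$-presentable. For $\nu$ regular, a $(\nu,<\lambda)$-system is a diagram of $(<\lambda)$-presentable objects indexed by a $\nu$-directed poset; such a system with colimit $(d_i:M_i\to M)_{i\in I}$ is proper if the identity of $M$ does not factor through any of the $d_i$. For $\theta$ regular, a category is $\theta$-accessible if it has $\theta$-directed colimits, has only a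 set of $\theta$-presentable objects up to isomorphism, and every object is a $\theta$-directed colimit of $\theta$-presentable objects. Theorem. Let $\mathbf K$ be a $\mu$-AEC and let $\lambda>\mathrm{LS}(\mathbf K)$ be a $\mu$-closed cardinal. Then: (a) there are no proper $(\lambda^+,<\lambda^+)$-systems in $\mathbf K$; (b) if moreover $\mathbf K$ is $\lambda^+$-accessible and has an object $M$ with $|UM|\ge\lambda$, then $\mathbf K$ has an object of presentability rank $\lambda^+$. -/

import Mathlib

open CategoryTheory CategoryTheory.Limits Cardinal

universe w v u

/-- A (possibly infinitary) vocabulary: a set of function symbols and a set of relation symbols,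
each with an arity, which is an arbitrary set. -/
structure Vocabulary : Type (w + 1) where
  Fun : Type w
  Rel : Type w
  funArity : Fun → Type w
  relArity : Rel → Type w

namespace Vocabulary

/-- All arities are strictly smaller than `μ`. -/
def IsAry (τ : Vocabulary.{w}) (μ : Cardinal.{w}) : Prop :=
  (∀ f, #(τ.funArity f) < μ) ∧ ∀ r, #(τ.relArity r) < μ

/-- The number of symbols. -/
noncomputable def card (τ : Vocabulary.{w}) : Cardinal.{w} := #τ.Fun + #τ.Rel

/-- A `τ`-structure. -/
structure Str (τ : Vocabulary.{w}) : Type (w + 1) where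
  carrier : Type w
  funMap : ∀ f : τ.Fun, (τ.funArity f → carrier) → carrier
  relMap : ∀ r : τ.Rel, (τ.relArity r → carrier) → Prop

variable {τ : Vocabulary.{w}}

/-- A substructure of `M`, given by its universe: a subset closed under the functions. -/
@[ext]
structure Substr (M : τ.Str) : Type w where
  carrier : Set M.carrier
  closed : ∀ (f : τ.Fun) (a : τ.funArity f → M.carrier),
    (∀ i, a i ∈ carrier) → M.funMap f a ∈ carrier

namespace Substr

variable {M : τ.Str}

/-- The `τ`-structure induced on a substructure. -/
def toStr (S : Substr M) : τ.Str where
  carrier := S.carrier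
  funMap f a := ⟨M.funMap f fun i => (a i).1, S.closed f _ fun i => (a i).2⟩
  relMap r a := M.relMap r fun i => (a i).1

/-- `M` as a substructure of itself. -/
def whole (M : τ.Str) : Substr M where
  carrier := Set.univ
  closed _ _ _ := Set.mem_univ _

/-- `S ∩ T` as a substructure of `T`; it is used for `S ⊆ T`, when it is `S` itself. -/
def within (S T : Substr M) : Substr T.toStr where
  carrier := {x : T.carrier | x.1 ∈ S.carrier}
  closed f _ ha := S.closed f _ ha

end Substr

/-- An embedding of `τ`-structures: a map which is an isomorphism onto its image. -/
@[ext]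
structure Emb (M N : τ.Str) : Type w where
  toFun : M.carrier → N.carrier
  injective : Function.Injective toFun
  map_fun : ∀ (f : τ.Fun) (a : τ.funArity f → M.carrier),
    toFun (M.funMap f a) = N.funMap f fun i => toFun (a i)
  map_rel : ∀ (r : τ.Rel) (a : τ.relArity r → M.carrier),
    M.relMap r a ↔ N.relMap r fun i => toFun (a i)

namespace Emb

variable {M N P : τ.Str}

/-- The identity embedding. -/
def id (M : τ.Str) : Emb M M where
  toFun x := x
  injective _ _ h := h
  map_fun _ _ := rfl
  map_rel _ _ := Iff.rfl

/-- The composite of `f : M → N` and `g : N → P`. -/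
def comp (f : Emb M N) (g : Emb N P) : Emb M P where
  toFun x := g.toFun (f.toFun x)
  injective _ _ h := f.injective (g.injective h)
  map_fun s a := by rw [f.map_fun, g.map_fun]
  map_rel r a := (f.map_rel r a).trans (g.map_rel r _)

/-- The image of an embedding. -/
def range (f : Emb M N) : Substr N where
  carrier := Set.range f.toFun
  closed s a ha := by
    choose b hb using ha
    exact ⟨M.funMap s b, by rw [f.map_fun]; exact congrArg _ (funext hb)⟩

/-- An embedding, with values in its image. -/
def toRange (f : Emb M N) : Emb M f.range.toStr where
  toFun x := ⟨f.toFun x, x, rfl⟩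
  injective _ _ h := f.injective (congrArg Subtype.val h)
  map_fun s a := Subtype.ext (f.map_fun s a)
  map_rel r a := f.map_rel r a

end Emb

end Vocabulary

open Vocabulary

/-- An abstract class of `τ`-structures. Since `M ≤ N` implies that `M` is a substructure of `N`,
the ordering `≤` is given by the relation `le N S`, which says that the structure `N`
is in the class and that the substructure `S` of `N` is in the class and satisfies `S ≤ N`.
Antisymmetry is automatic. -/
structure AbstractClass (τ : Vocabulary.{w}) where
  mem : τ.Str → Prop
  le : ∀ N : τ.Str, Substr N → Prop
  mem_of_le : ∀ (N : τ.Str) (S : Substr N), le N S → mem N ∧ mem S.toStr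
  le_refl : ∀ N : τ.Str, mem N → le N (Substr.whole N)
  le_trans : ∀ (N : τ.Str) (S T : Substr N), S.carrier ⊆ T.carrier →
    le T.toStr (S.within T) → le N T → le N S
  mem_iso : ∀ (N N' : τ.Str) (e : Emb N N'), Function.Surjective e.toFun → mem N → mem N'
  le_iso : ∀ (N N' : τ.Str) (e : Emb N N'), Function.Surjective e.toFun →
    ∀ (S : Substr N) (S' : Substr N'), (∀ x, x ∈ S.carrier ↔ e.toFun x ∈ S'.carrier) →
      le N S → le N' S'

/-- A poset is `μ`-directed if every subset with fewer than `μ` elements has an upper bound. -/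
def IsMuDirected (μ : Cardinal.{w}) (I : Type w) [PartialOrder I] : Prop :=
  ∀ s : Set I, #s < μ → BddAbove s

namespace AbstractClass

variable {τ : Vocabulary.{w}} (K : AbstractClass τ)

/-- `S ≤ T`, for two substructures `S`, `T` of a common structure
(which need not be in the class). -/
def LeIn {M : τ.Str} (S T : Substr M) : Prop :=
  S.carrier ⊆ T.carrier ∧ K.le T.toStr (S.within T)

/-- `S` is a `μ`-directed system in `K`, all of whose members are substructures of the
structure `M` (which need not be in the class). -/
def IsDirectedSystem (μ : Cardinal.{w}) {M : τ.Str} {I : Type w} [PartialOrder I]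
    (S : I → Substr M) : Prop :=
  IsMuDirected μ I ∧ (∀ i, K.mem (S i).toStr) ∧ ∀ i j, i ≤ j → K.LeIn (S i) (S j)

/-- The instance of the Löwenheim-Skolem-Tarski axiom at the cardinal `κ`. -/
def LST (μ κ : Cardinal.{w}) : Prop :=
  κ = κ ^< μ ∧ τ.card + μ ≤ κ ∧
    ∀ M : τ.Str, K.mem M → ∀ A : Set M.carrier,
      ∃ S : Substr M, K.le M S ∧ A ⊆ S.carrier ∧ #S.carrier ≤ #A ^< μ + κ

/-- `K` is a `μ`-abstract elementary class. -/
structure IsMuAEC (μ : Cardinal.{w}) : Prop where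
  regular : μ.IsRegular
  ary : τ.IsAry μ
  coherence : ∀ (N : τ.Str) (S T : Substr N), S.carrier ⊆ T.carrier →
    K.le N S → K.le N T → K.le T.toStr (S.within T)
  /-- The union `M` of a `μ`-directed system is in `K`, and is above every member. -/
  chain_mem : ∀ (M : τ.Str) (I : Type w) [PartialOrder I] (S : I → Substr M),
    K.IsDirectedSystem μ S → (∀ x, ∃ i, x ∈ (S i).carrier) → K.mem M ∧ ∀ i, K.le M (S i)
  /-- If all members of a `μ`-directed system are below `N`, so is their union `U`. -/
  chain_le : ∀ (N : τ.Str) (I : Type w) [PartialOrder I] (S : I → Substr N),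
    K.IsDirectedSystem μ S → (∀ i, K.le N (S i)) →
      ∀ U : Substr N, (∀ x, x ∈ U.carrier ↔ ∃ i, x ∈ (S i).carrier) → K.le N U
  lst : ∃ κ, K.LST μ κ

/-- The Löwenheim-Skolem-Tarski number of a `μ`-abstract elementary class. -/
noncomputable def LS (μ : Cardinal.{w}) : Cardinal.{w} := sInf {κ | K.LST μ κ}

/-- The objects of the category associated with `K`. -/
structure Obj : Type (w + 1) where
  str : τ.Str
  mem : K.mem str

/-- The morphisms `M ⟶ N` of the category associated with `K`: the embeddings `f` with
`f[M] ≤ N`. -/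
@[ext]
structure Hom (M N : K.Obj) : Type w where
  emb : Emb M.str N.str
  range_le : K.le N.str emb.range

instance : Category.{w} K.Obj where
  Hom M N := K.Hom M N
  id M := ⟨Emb.id M.str, by
    have h : (Emb.id M.str).range = Substr.whole M.str := by
      ext x
      simp [Emb.range, Emb.id, Substr.whole]
    rw [h]
    exact K.le_refl _ M.mem⟩
  comp {M N P} f g := ⟨f.emb.comp g.emb, by
    refine K.le_trans P.str _ g.emb.range ?_ ?_ g.range_le
    · rintro _ ⟨x, rfl⟩
      exact ⟨f.emb.toFun x, rfl⟩
    · refine K.le_iso N.str _ g.emb.toRange ?_ f.emb.range _ ?_ f.range_le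
      · rintro ⟨_, x, rfl⟩
        exact ⟨x, rfl⟩
      · intro x
        constructor
        · rintro ⟨y, rfl⟩
          exact ⟨y, rfl⟩
        · rintro ⟨y, hy⟩
          exact ⟨y, g.emb.injective hy⟩⟩

end AbstractClass

/-- `κ` is `μ`-closed if `θ ^ (<μ) < κ` for all `θ < κ`. -/
def IsMuClosed (μ κ : Cardinal.{w}) : Prop := ∀ θ < κ, θ ^< μ < κ

section Presentability

variable {C : Type u} [Category.{v} C]

/-- `κ` is a regular cardinal and `X` is `κ`-presentable. -/
def IsPresentableAt (X : C) (κ : Cardinal.{w}) : Prop :=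
  ∃ _ : Fact κ.IsRegular, IsCardinalPresentable X κ

/-- `X` is `(<κ)`-presentable. -/
def IsLTPresentable (X : C) (κ : Cardinal.{w}) : Prop :=
  ∃ θ : Cardinal.{w}, θ < κ + ℵ_ 1 ∧ IsPresentableAt X θ

/-- The presentability rank of `X` is `κ`. -/
def HasPresentabilityRank (X : C) (κ : Cardinal.{w}) : Prop :=
  IsLeast {θ | IsPresentableAt X θ} κ

/-- `D` is a `(μ, <κ)`-system. -/
def IsSystem (μ κ : Cardinal.{w}) {I : Type w} [PartialOrder I] (D : I ⥤ C) : Prop :=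
  IsMuDirected μ I ∧ ∀ i, IsLTPresentable (D.obj i) κ

/-- A system with colimit `c` is proper if the identity of the colimit
does not factor through any object in the system. -/
def IsProper {I : Type w} [PartialOrder I] {D : I ⥤ C} (c : Cocone D) : Prop :=
  ∀ i, ¬ ∃ g : c.pt ⟶ D.obj i, g ≫ c.ι.app i = 𝟙 c.pt

variable (C) in
/-- `κ` is a regular cardinal and `C` is a `κ`-accessible category. -/
def IsAccessibleAt (κ : Cardinal.{w}) : Prop :=
  ∃ _ : Fact κ.IsRegular, IsCardinalAccessibleCategory C κ

end Presentability

/-! The crux is a strict size bound: an object presentable at some regular `θ ≤ κ` has fewer than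
`κ` elements. For regular `μ`-closed `ν > LS`, Löwenheim-Skolem makes every `M` the `ν`-directed
colimit of its substructures `S ≤ M` of size `< ν`; if `M` is `ν`-presentable, its identity factors
through one of them, so `|M| < ν`. If `κ` is singular, take `ν` to be a suitable successor with `θ ≤
ν ≤ κ`. Conversely, a `κ⁺`-directed colimit of objects of size `< κ` is the image of one of them:
`κ` many elements of the colimit would already come from a single object. For (a), that coprojection
is an isomorphism, so the system is not proper. For (b), without an object of rank `κ⁺` every
`κ⁺`-presentable object has size `< κ`, and by accessibility so does every object. -/

/-! ### Cardinal arithmetic of `x ^< μ` -/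

namespace Cardinal

/-- For regular `μ ≤ x`, the cardinal `x ^< μ` is closed under exponents smaller than `μ`. -/
theorem powerlt_powerlt_le {x μ : Cardinal.{w}} (hμ : μ.IsRegular) (hx : μ ≤ x) :
    (x ^< μ) ^< μ ≤ x ^< μ := by
  have hIio : ∀ {c : Cardinal.{w}} (i : c.ord.ToType), #(Set.Iio i) < c := fun i => by
    simpa using mk_Iio_lt i (by simp)
  have hx0 : x ≠ 0 := (hμ.pos.trans_le hx).ne'
  refine powerlt_le.2 fun β hβ => ?_
  induction β using Cardinal.inductionOn with | _ B
  -- Each point of the well-order `V` has fewer than `x ^ a` predecessors for some `a < μ`. By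
  -- regularity of `μ`, a map from `B` to `V` has one bound `c < μ` for all its values, so it lands
  -- in a set of size at most `x ^ c`.
  let V := (x ^< μ).ord.ToType
  have hV : #V = x ^< μ := mk_ord_toType _
  have hex : ∀ v : V, ∃ a < μ, #(Set.Iio v) < x ^ a := by
    intro v
    by_contra! h
    exact (hIio v).not_ge (powerlt_le.2 h)
  choose a haμ ha using hex
  let W : Cardinal.{w} → Set V := fun c => {v | #(Set.Iio v) < x ^ c}
  have hW : ∀ c, #(W c) ≤ x ^ c := by
    intro c
    have hlt : ∀ v : W c, Ordinal.typein (α := V) (· < ·) v.1 < (x ^ c).ord := by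
      intro v
      rw [lt_ord]
      exact v.2
    rw [← mk_ord_toType (x ^ c)]
    refine mk_le_of_injective (f := fun v : W c => Ordinal.ToType.mk ⟨_, Set.mem_Iio.2 (hlt v)⟩) ?_
    intro v v' h
    have h1 := Ordinal.ToType.mk.injective h
    exact Subtype.ext ((Ordinal.typein_inj _).1 (congrArg Subtype.val h1))
  -- Cardinals below `μ` are coded by points of a well-order of size `μ`, so that the sum over all
  -- bounds has only `μ` terms.
  have hcard : ∀ c < μ, ∃ i : μ.ord.ToType, #(Set.Iio i) = c := by
    intro c hc
    obtain ⟨i, hi⟩ := Ordinal.typein_surj (α := μ.ord.ToType) (· < ·) (o := c.ord) (by simpa)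
    refine ⟨i, ?_⟩
    change (Ordinal.typein (α := μ.ord.ToType) (· < ·) i).card = c
    rw [hi, card_ord]
  have hbd : ∀ f : B → V, ∃ i : μ.ord.ToType, ∀ b, f b ∈ W #(Set.Iio i) := by
    intro f
    obtain ⟨i, hi⟩ := hcard (⨆ b, a (f b))
      (iSup_lt_of_lt_cof_ord (by rwa [hμ.cof_ord]) fun b => haμ _)
    refine ⟨i, fun b => (ha (f b)).trans_le ?_⟩
    rw [hi]
    exact power_le_power_left hx0 (le_ciSup bddAbove_of_small b)
  choose i hi using hbd
  have hinj : Function.Injective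
      (fun f : B → V => (⟨i f, fun b => ⟨f b, hi f b⟩⟩ :
        Σ j : μ.ord.ToType, B → W #(Set.Iio j))) := by
    intro f g h
    have hval : ∀ p q : (Σ j : μ.ord.ToType, B → W #(Set.Iio j)), p = q →
        (fun b => (p.2 b).1) = fun b => (q.2 b).1 := by
      rintro p _ rfl
      rfl
    exact hval _ _ h
  have hle : x ≤ x ^< μ := by
    simpa using le_powerlt x (one_lt_aleph0.trans_le hμ.aleph0_le)
  calc (x ^< μ) ^ #B = #(B → V) := by rw [← power_def, hV]
    _ ≤ #(Σ j : μ.ord.ToType, B → W #(Set.Iio j)) := mk_le_of_injective hinj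
    _ = Cardinal.sum fun j : μ.ord.ToType => #(B → W #(Set.Iio j)) := mk_sigma _
    _ ≤ Cardinal.sum fun _ : μ.ord.ToType => x ^< μ := by
      refine sum_le_sum _ _ fun j => ?_
      rw [← power_def]
      calc #(W #(Set.Iio j)) ^ #B ≤ (x ^ #(Set.Iio j)) ^ #B := power_le_power_right (hW _)
        _ = x ^ (#(Set.Iio j) * #B) := (power_mul ..).symm
        _ ≤ x ^< μ :=
          le_powerlt x (mul_lt_of_lt hμ.aleph0_le (hIio j) hβ)
    _ = μ * x ^< μ := by rw [sum_const', mk_ord_toType]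
    _ ≤ x ^< μ :=
      mul_le_of_le (hμ.aleph0_le.trans (hx.trans hle)) (hx.trans hle) le_rfl

theorem powerlt_mono_right {x y : Cardinal.{w}} (μ : Cardinal.{w}) (h : x ≤ y) :
    x ^< μ ≤ y ^< μ :=
  powerlt_le.2 fun _ hc => (power_le_power_right h).trans (le_powerlt y hc)

/-- Below a `μ`-closed cardinal `κ`, every regular cardinal lies under a regular `μ`-closed
cardinal which is at most `κ`. -/
theorem exists_isRegular_isMuClosed {μ κ l θ : Cardinal.{w}} (hμ : μ.IsRegular) (hl : μ ≤ l)
    (hlκ : l < κ) (hκ : IsMuClosed μ κ) (hθ : θ.IsRegular) (hθκ : θ ≤ κ) :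
    ∃ ν : Cardinal.{w}, ν.IsRegular ∧ θ ≤ ν ∧ l < ν ∧ ν ≤ κ ∧ IsMuClosed μ ν := by
  by_cases hreg : κ.IsRegular
  · exact ⟨κ, hreg, hθκ, hlκ, le_rfl, hκ⟩
  have hlt : θ < κ := hθκ.lt_of_ne fun h => hreg (h ▸ hθ)
  have hmax : μ ≤ max θ l := hl.trans (le_max_right _ _)
  have hle : max θ l ≤ max θ l ^< μ := by
    simpa using le_powerlt (max θ l) (one_lt_aleph0.trans_le hμ.aleph0_le)
  -- A successor is regular, and this one is `μ`-closed because `x ^< μ` is idempotent for `x ≥ μ`.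
  refine ⟨Order.succ (max θ l ^< μ), isRegular_succ (hθ.aleph0_le.trans ?_), ?_, ?_, ?_, ?_⟩
  · exact (le_max_left _ _).trans hle
  · exact ((le_max_left _ _).trans hle).trans (Order.le_succ _)
  · exact Order.lt_succ_of_le ((le_max_right _ _).trans hle)
  · exact Order.succ_le_of_lt (hκ _ (max_lt hlt hlκ))
  · intro α hα
    exact Order.lt_succ_of_le ((powerlt_mono_right μ (Order.le_of_lt_succ hα)).trans
      (powerlt_powerlt_le hμ hmax))

end Cardinal

/-! ### Substructures and embeddings -/

namespace Vocabulary

variable {τ : Vocabulary.{w}}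

/-- Substructures are ordered by inclusion. -/
instance Substr.instPartialOrder (M : τ.Str) : PartialOrder (Substr M) :=
  PartialOrder.lift Substr.carrier fun _ _ => Substr.ext

/-- The inclusion of a substructure. -/
def Substr.incl {M : τ.Str} (S : Substr M) : Emb S.toStr M where
  toFun := Subtype.val
  injective := Subtype.val_injective
  map_fun _ _ := rfl
  map_rel _ _ := Iff.rfl

theorem Substr.range_incl {M : τ.Str} (S : Substr M) : S.incl.range = S :=
  Substr.ext Subtype.range_coe

/-- An embedding with values in a substructure. -/
def Emb.codRestrict {M N : τ.Str} (f : Emb M N) (U : Substr N)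
    (h : ∀ x, f.toFun x ∈ U.carrier) : Emb M U.toStr where
  toFun x := ⟨f.toFun x, h x⟩
  injective _ _ e := f.injective (congrArg Subtype.val e)
  map_fun s a := Subtype.ext (f.map_fun s a)
  map_rel r a := f.map_rel r a

theorem Emb.range_codRestrict {M N : τ.Str} (f : Emb M N) (U : Substr N)
    (h : ∀ x, f.toFun x ∈ U.carrier) : (f.codRestrict U h).range = f.range.within U := by
  ext y
  exact exists_congr fun x => Subtype.ext_iff

/-- The inverse of a bijective embedding. -/
noncomputable def Emb.symm {M N : τ.Str} (f : Emb M N) (hf : Function.Surjective f.toFun) :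
    Emb N M where
  toFun := Function.surjInv hf
  injective := Function.injective_surjInv hf
  map_fun s a := f.injective (by
    rw [Function.surjInv_eq hf, f.map_fun]
    simp only [Function.surjInv_eq hf])
  map_rel r a := by
    rw [f.map_rel]
    simp only [Function.surjInv_eq hf]

end Vocabulary

/-! ### Morphisms and directed unions -/

namespace AbstractClass

variable {τ : Vocabulary.{w}} {K : AbstractClass τ} {μ : Cardinal.{w}}

theorem comp_toFun {M N P : K.Obj} (f : M ⟶ N) (g : N ⟶ P) (x : M.str.carrier) :
    (f ≫ g).emb.toFun x = g.emb.toFun (f.emb.toFun x) := rfl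

theorem id_toFun (M : K.Obj) (x : M.str.carrier) : (𝟙 M : M ⟶ M).emb.toFun x = x := rfl

theorem hom_ext {M N : K.Obj} {f g : M ⟶ N} (h : ∀ x, f.emb.toFun x = g.emb.toFun x) :
    f = g :=
  Hom.ext (Emb.ext (funext h))

/-- A surjective morphism has a section. -/
theorem exists_section {M N : K.Obj} (f : M ⟶ N) (hf : Function.Surjective f.emb.toFun) :
    ∃ g : N ⟶ M, g ≫ f = 𝟙 N := by
  have hr : (f.emb.symm hf).range = Substr.whole M.str := by
    ext x
    refine ⟨fun _ => Set.mem_univ _, fun _ => ⟨f.emb.toFun x, ?_⟩⟩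
    exact f.emb.injective (Function.surjInv_eq hf _)
  exact ⟨⟨f.emb.symm hf, hr ▸ K.le_refl _ M.mem⟩, hom_ext fun x => Function.surjInv_eq hf x⟩

/-- A substructure `S ≤ M` as an object. -/
def ofLE {M : τ.Str} {S : Substr M} (h : K.le M S) : K.Obj := ⟨S.toStr, (K.mem_of_le _ _ h).2⟩

/-- The inclusion `S ⟶ M`, for `S ≤ M`. -/
def inclHom {M : K.Obj} {S : Substr M.str} (h : K.le M.str S) : ofLE h ⟶ M :=
  ⟨S.incl, S.range_incl.symm ▸ h⟩

namespace IsMuAEC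

/-- A morphism with values in `U ≤ N` is a morphism to `U`. -/
def liftHom (hK : K.IsMuAEC μ) {M N : K.Obj} (f : M ⟶ N) {U : Substr N.str}
    (hU : K.le N.str U) (h : ∀ x, f.emb.toFun x ∈ U.carrier) : M ⟶ ofLE hU :=
  ⟨f.emb.codRestrict U h, by
    change K.le U.toStr (f.emb.codRestrict U h).range
    rw [Emb.range_codRestrict]
    refine hK.coherence _ _ _ ?_ f.range_le hU
    rintro _ ⟨x, rfl⟩
    exact h x⟩

/-- The union of a family of substructures `S ≤ N` which is `μ`-directed under inclusion
is `≤ N`. -/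
theorem le_of_directed_union (hK : K.IsMuAEC μ) {N : τ.Str} (F : Set (Substr N))
    (hF : ∀ S ∈ F, K.le N S) (hdir : ∀ s : Set F, #s < μ → BddAbove s) (U : Substr N)
    (hU : ∀ x, x ∈ U.carrier ↔ ∃ S ∈ F, x ∈ S.carrier) : K.le N U := by
  refine hK.chain_le N F (fun S => S.1) ⟨hdir, fun S => (K.mem_of_le _ _ (hF _ S.2)).2, ?_⟩
    (fun S => hF _ S.2) U fun x => by simp [hU]
  exact fun S T hST => ⟨hST, hK.coherence _ _ _ hST (hF _ S.2) (hF _ T.2)⟩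

theorem lst_LS (hK : K.IsMuAEC μ) : K.LST μ (K.LS μ) := csInf_mem (s := {κ | K.LST μ κ}) hK.lst

theorem le_LS (hK : K.IsMuAEC μ) : μ ≤ K.LS μ := le_add_self.trans hK.lst_LS.2.1

/-! ### Filtered colimits -/

section Colimits

variable {J : Type w} [SmallCategory J] {ν : Cardinal.{w}} [Fact ν.IsRegular]
  [IsCardinalFiltered J ν] {D : J ⥤ K.Obj}

theorem ι_map_toFun (c : Cocone D) {j k : J} (f : j ⟶ k) (y : (D.obj j).str.carrier) :
    (c.ι.app k).emb.toFun ((D.map f).emb.toFun y) = (c.ι.app j).emb.toFun y := by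
  rw [← comp_toFun, c.w]

/-- In a `ν`-filtered diagram, fewer than `ν` elements of the images in a cocone come from a
single object. -/
theorem exists_forall_mem_range (c : Cocone D) {A : Type w} (hA : #A < ν)
    (x : A → c.pt.str.carrier) (hx : ∀ a, ∃ j y, (c.ι.app j).emb.toFun y = x a) :
    ∃ j, ∀ a, ∃ y, (c.ι.app j).emb.toFun y = x a := by
  choose j y hy using hx
  have hA' : HasCardinalLT A ν := by rwa [hasCardinalLT_iff_cardinal_mk_lt]
  refine ⟨IsCardinalFiltered.max j hA', fun a =>
    ⟨(D.map (IsCardinalFiltered.toMax j hA' a)).emb.toFun (y a), ?_⟩⟩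
  rw [ι_map_toFun, hy]

variable (ν) in
/-- The union of the images of a `ν`-filtered diagram in a cocone is a substructure. -/
def unionRange (hK : K.IsMuAEC μ) (hμν : μ ≤ ν) (c : Cocone D) : Substr c.pt.str where
  carrier := {x | ∃ j y, (c.ι.app j).emb.toFun y = x}
  closed f a ha := by
    obtain ⟨j, hj⟩ := exists_forall_mem_range c ((hK.ary.1 f).trans_le hμν) a ha
    choose y hy using hj
    refine ⟨j, (D.obj j).str.funMap f y, ?_⟩
    rw [Emb.map_fun]
    exact congrArg _ (funext hy)

/-- Since `μ ≤ ν`, the images form a `μ`-directed family under inclusion, so the union axiom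
applies. The images serve as indices because `J` need not be a poset. -/
theorem unionRange_le (hK : K.IsMuAEC μ) (hμν : μ ≤ ν) (c : Cocone D) :
    K.le c.pt.str (unionRange ν hK hμν c) := by
  refine hK.le_of_directed_union (Set.range fun j => (c.ι.app j).emb.range) ?_ ?_ _ ?_
  · rintro _ ⟨j, rfl⟩
    exact (c.ι.app j).range_le
  · intro s hs
    have hex : ∀ S : s, ∃ j, (c.ι.app j).emb.range = S.1.1 := fun S => S.1.2
    choose j hj using hex
    have hs' : HasCardinalLT s ν := by
      rw [hasCardinalLT_iff_cardinal_mk_lt]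
      exact hs.trans_le hμν
    refine ⟨⟨_, IsCardinalFiltered.max j hs', rfl⟩, fun S hS => ?_⟩
    change S.1.carrier ⊆ _
    rw [← hj ⟨S, hS⟩]
    rintro _ ⟨y, rfl⟩
    exact ⟨(D.map (IsCardinalFiltered.toMax j hs' ⟨S, hS⟩)).emb.toFun y, ι_map_toFun c _ y⟩
  · intro x
    constructor
    · rintro ⟨j, y, h⟩
      exact ⟨_, ⟨j, rfl⟩, y, h⟩
    · rintro ⟨_, ⟨j, rfl⟩, y, h⟩
      exact ⟨j, y, h⟩

/-- Colimits of `ν`-filtered diagrams, for `μ ≤ ν`, are covered by the images of the objects. -/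
theorem jointly_surjective (hK : K.IsMuAEC μ) (hμν : μ ≤ ν) {c : Cocone D} (hc : IsColimit c)
    (x : c.pt.str.carrier) : ∃ j y, (c.ι.app j).emb.toFun y = x := by
  have hU := unionRange_le hK hμν c
  let s : Cocone D :=
    { pt := ofLE hU
      ι :=
        { app := fun j => hK.liftHom (c.ι.app j) hU fun y => ⟨j, y, rfl⟩
          naturality := fun j k f => hom_ext fun y => Subtype.ext (ι_map_toFun c f y) } }
  -- The cocone factors through the union `U` of the images, so the inclusion of `U` is split by the
  -- induced map, hence onto.
  have h : hc.desc s ≫ inclHom hU = 𝟙 c.pt := by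
    refine hc.hom_ext fun j => ?_
    rw [← Category.assoc, hc.fac, Category.comp_id]
    exact hom_ext fun y => rfl
  have hx : (inclHom hU).emb.toFun ((hc.desc s).emb.toFun x) = x := by
    rw [← comp_toFun, h, id_toFun]
  rw [← hx]
  exact ((hc.desc s).emb.toFun x).2

/-- If all objects of a `ν`-filtered diagram have size `< κ < ν`, then the diagram
reaches its colimit. -/
theorem exists_surjective_ι (hK : K.IsMuAEC μ) {κ : Cardinal.{w}} (hμν : μ ≤ ν) (hκν : κ < ν)
    {c : Cocone D} (hc : IsColimit c) (hD : ∀ j, #(D.obj j).str.carrier < κ) :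
    ∃ j, Function.Surjective (c.ι.app j).emb.toFun := by
  -- Otherwise `κ < ν` elements of the colimit lift to one object, which is too small. Once this is
  -- known, the whole colimit has fewer than `ν` elements and lifts likewise.
  have hlt : #c.pt.str.carrier < κ := by
    by_contra! hle
    obtain ⟨A, hA⟩ := le_mk_iff_exists_set.1 hle
    obtain ⟨j, hj⟩ := exists_forall_mem_range c (hA.trans_lt hκν) (fun a : A => a.1)
      fun a => hK.jointly_surjective hμν hc a.1
    choose y hy using hj
    have hinj : Function.Injective y := fun a b h => Subtype.ext (by rw [← hy a, ← hy b, h])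
    exact (hD j).not_ge (hA ▸ mk_le_of_injective hinj)
  exact exists_forall_mem_range c (hlt.trans hκν) id (hK.jointly_surjective hμν hc)

end Colimits

/-! ### Objects as colimits of small substructures -/

/-- The substructures `S ≤ M` of size `< θ`. -/
abbrev SmallSub (M : K.Obj) (θ : Cardinal.{w}) : Type w :=
  {S : Substr M.str // K.le M.str S ∧ #S.carrier < θ}

section SmallSub

variable {θ : Cardinal.{w}} {M : K.Obj}

/-- Closedness keeps the Löwenheim-Skolem bound `|A| ^< μ + LS` below `θ`. -/
theorem exists_smallSub (hK : K.IsMuAEC μ) (hLS : K.LS μ < θ) (hθ : IsMuClosed μ θ)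
    (A : Set M.str.carrier) (hA : #A < θ) : ∃ S : SmallSub M θ, A ⊆ S.1.carrier := by
  obtain ⟨S, hS, hAS, hcard⟩ := hK.lst_LS.2.2 M.str M.mem A
  refine ⟨⟨S, hS, hcard.trans_lt (add_lt_of_lt ?_ (hθ _ hA) hLS)⟩, hAS⟩
  exact hK.regular.aleph0_le.trans (hK.le_LS.trans hLS.le)

theorem isMuDirected_smallSub (hK : K.IsMuAEC μ) (hreg : θ.IsRegular) (hLS : K.LS μ < θ)
    (hθ : IsMuClosed μ θ) : IsMuDirected θ (SmallSub M θ) := by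
  intro s hs
  obtain ⟨T, hT⟩ := hK.exists_smallSub hLS hθ (⋃ S : s, S.1.1.carrier)
    ((card_iUnion_lt_iff_forall_of_isRegular hreg hs).2 fun S => S.1.2.2)
  exact ⟨T, fun S hS => (Set.subset_iUnion (fun S : s => S.1.1.carrier) ⟨S, hS⟩).trans hT⟩

theorem isCardinalFiltered_of_isMuDirected [Fact θ.IsRegular] {I : Type w} [PartialOrder I]
    (hI : IsMuDirected θ I) : IsCardinalFiltered I θ :=
  isCardinalFiltered_preorder I θ fun A s hA => by
    obtain ⟨j, hj⟩ := hI (Set.range s) (mk_range_le.trans_lt hA)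
    exact ⟨j, fun k => hj ⟨k, rfl⟩⟩

variable (M θ) in
/-- The diagram of the substructures `S ≤ M` of size `< θ`. -/
def smallSubFunctor (hK : K.IsMuAEC μ) : SmallSub M θ ⥤ K.Obj where
  obj S := ofLE S.2.1
  map {S T} f := hK.liftHom (inclHom S.2.1) T.2.1 fun x => leOfHom f x.2
  map_id _ := hom_ext fun _ => rfl
  map_comp _ _ := hom_ext fun _ => rfl

variable (M θ) in
/-- The cocone of the inclusions of the substructures `S ≤ M` of size `< θ`. -/
def smallSubCocone (hK : K.IsMuAEC μ) : Cocone (smallSubFunctor θ M hK) where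
  pt := M
  ι :=
    { app := fun S => inclHom S.2.1
      naturality := fun _ _ _ => hom_ext fun _ => rfl }

theorem ι_apply_eq (hK : K.IsMuAEC μ) (s : Cocone (smallSubFunctor θ M hK))
    {S T : SmallSub M θ} (h : S ≤ T) (x : M.str.carrier) (hx : x ∈ S.1.carrier) :
    (s.ι.app T).emb.toFun ⟨x, h hx⟩ = (s.ι.app S).emb.toFun ⟨x, hx⟩ :=
  ι_map_toFun s (homOfLE h) ⟨x, hx⟩

/-- Every object is the colimit of its substructures of size `< θ`. -/
theorem nonempty_isColimit_smallSubCocone (hK : K.IsMuAEC μ) (hreg : θ.IsRegular)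
    (hLS : K.LS μ < θ) (hθ : IsMuClosed μ θ) :
    Nonempty (IsColimit (smallSubCocone θ M hK)) := by
  have hμθ : μ < θ := hK.le_LS.trans_lt hLS
  have : Fact θ.IsRegular := ⟨hreg⟩
  have hdir := hK.isMuDirected_smallSub (M := M) hreg hLS hθ
  have := isCardinalFiltered_of_isMuDirected hdir
  have htup : ∀ {A : Type w} (_ : #A < θ) (x : A → M.str.carrier),
      ∃ S : SmallSub M θ, ∀ a, x a ∈ S.1.carrier := fun hA x =>
    (hK.exists_smallSub hLS hθ (Set.range x) (mk_range_le.trans_lt hA)).imp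
      fun S hS a => hS ⟨a, rfl⟩
  have hcov : ∀ x : M.str.carrier, ∃ S : SmallSub M θ, x ∈ S.1.carrier := fun x =>
    (htup (A := PUnit) (by simpa using one_lt_aleph0.trans_le hreg.aleph0_le) fun _ => x).imp
      fun S hS => hS ⟨⟩
  -- The induced map is evaluated at `x` through a chosen `σ x`; directedness makes the value
  -- independent of the choice.
  choose σ hσ using hcov
  have hind : ∀ (s : Cocone (smallSubFunctor θ M hK)) (S : SmallSub M θ) (x : M.str.carrier)
      (hx : x ∈ S.1.carrier), (s.ι.app (σ x)).emb.toFun ⟨x, hσ x⟩ =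
        (s.ι.app S).emb.toFun ⟨x, hx⟩ := by
    intro s S x hx
    obtain ⟨T, hT⟩ := hdir {σ x, S} ((lt_aleph0_of_finite _).trans_le hreg.aleph0_le)
    rw [← ι_apply_eq hK s (hT (Set.mem_insert _ _)),
      ← ι_apply_eq hK s (hT (Set.mem_insert_of_mem _ rfl))]
  let e : ∀ s : Cocone (smallSubFunctor θ M hK), Emb M.str s.pt.str := fun s =>
    { toFun := fun x => (s.ι.app (σ x)).emb.toFun ⟨x, hσ x⟩
      injective := by
        intro x y hxy
        obtain ⟨T, hT⟩ := hdir {σ x, σ y} ((lt_aleph0_of_finite _).trans_le hreg.aleph0_le)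
        have h1 : x ∈ T.1.carrier := hT (Set.mem_insert _ _) (hσ x)
        have h2 : y ∈ T.1.carrier := hT (Set.mem_insert_of_mem _ rfl) (hσ y)
        dsimp only at hxy
        rw [hind s T x h1, hind s T y h2] at hxy
        exact congrArg Subtype.val ((s.ι.app T).emb.injective hxy)
      map_fun := by
        intro f a
        -- Arities are below `μ < θ`, so a whole tuple lies in one small substructure.
        obtain ⟨S, hS⟩ := htup ((hK.ary.1 f).trans hμθ) a
        rw [hind s S _ (S.1.closed f a hS)]
        simp only [hind s S _ (hS _)]
        exact (s.ι.app S).emb.map_fun f fun i => ⟨a i, hS i⟩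
      map_rel := by
        intro r a
        obtain ⟨S, hS⟩ := htup ((hK.ary.2 r).trans hμθ) a
        simp only [hind s S _ (hS _)]
        exact (s.ι.app S).emb.map_rel r fun i => ⟨a i, hS i⟩ }
  have he : ∀ s, K.le s.pt.str (e s).range := by
    intro s
    have h : (e s).range = unionRange θ hK hμθ.le s := by
      ext y
      constructor
      · rintro ⟨x, rfl⟩
        exact ⟨σ x, ⟨x, hσ x⟩, rfl⟩
      · rintro ⟨S, x, rfl⟩
        exact ⟨x.1, hind s S x.1 x.2⟩
    rw [h]
    exact unionRange_le hK hμθ.le s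
  exact ⟨{ desc := fun s => ⟨e s, he s⟩
           fac := fun s S => hom_ext fun x => hind s S x.1 x.2
           uniq := fun s m hm => hom_ext fun x => by
             rw [← show m.emb.toFun x = _ from
               congrArg (fun f => f.emb.toFun ⟨x, hσ x⟩) (hm (σ x))] }⟩

/-- For regular `μ`-closed `θ`, a `θ`-presentable object has size `< θ`. -/
theorem mk_lt_of_isCardinalPresentable (hK : K.IsMuAEC μ) [Fact θ.IsRegular]
    (hLS : K.LS μ < θ) (hθ : IsMuClosed μ θ) [IsCardinalPresentable M θ] :
    #M.str.carrier < θ := by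
  have hreg : θ.IsRegular := Fact.out
  have := isCardinalFiltered_of_isMuDirected (hK.isMuDirected_smallSub (M := M) hreg hLS hθ)
  obtain ⟨hc⟩ := hK.nonempty_isColimit_smallSubCocone (M := M) hreg hLS hθ
  obtain ⟨S, g, hg⟩ := IsCardinalPresentable.exists_hom_of_isColimit θ hc (𝟙 M)
  exact (mk_le_of_injective g.emb.injective).trans_lt S.2.2

end SmallSub

/-! ### Presentability bounds size -/

variable {κ : Cardinal.{w}}

/-- If `κ` is `μ`-closed, objects presentable at a regular cardinal `≤ κ` have size `< κ`. -/
theorem mk_lt_of_isPresentableAt (hK : K.IsMuAEC μ) (hLS : K.LS μ < κ) (hκ : IsMuClosed μ κ)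
    {M : K.Obj} {θ : Cardinal.{w}} (hθ : θ ≤ κ) (hM : IsPresentableAt M θ) :
    #M.str.carrier < κ := by
  obtain ⟨hreg, hpres⟩ := hM
  obtain ⟨ν, hν, hθν, hLSν, hνκ, hcl⟩ :=
    exists_isRegular_isMuClosed hK.regular hK.le_LS hLS hκ hreg.out hθ
  have : Fact ν.IsRegular := ⟨hν⟩
  have := isCardinalPresentable_of_le M hθν
  exact (hK.mk_lt_of_isCardinalPresentable hLSν hcl).trans_le hνκ

/-- As `κ` is infinite, the summand `ℵ_ 1` is absorbed, and the witness satisfies `θ ≤ κ`. -/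
theorem mk_lt_of_isLTPresentable (hK : K.IsMuAEC μ) (hLS : K.LS μ < κ) (hκ : IsMuClosed μ κ)
    {M : K.Obj} (hM : IsLTPresentable M (Order.succ κ)) : #M.str.carrier < κ := by
  obtain ⟨θ, hθ, hM⟩ := hM
  have h0 : ℵ₀ ≤ κ := hK.regular.aleph0_le.trans (hK.le_LS.trans hLS.le)
  have h1 : ℵ_ 1 ≤ Order.succ κ := by
    rw [← succ_aleph0]
    exact Order.succ_le_succ h0
  rw [add_eq_left (h0.trans (Order.le_succ κ)) h1] at hθ
  exact hK.mk_lt_of_isPresentableAt hLS hκ (Order.le_of_lt_succ hθ) hM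

end IsMuAEC

end AbstractClass

theorem mainTheorem11 {τ : Vocabulary.{w}} (K : AbstractClass τ) (μ : Cardinal.{w})
    (hK : K.IsMuAEC μ) (κ : Cardinal.{w}) (hLS : K.LS μ < κ) (hκ : IsMuClosed μ κ) :
    (∀ (I : Type w) [PartialOrder I] (D : I ⥤ K.Obj) (c : Cocone D),
      IsSystem (Order.succ κ) (Order.succ κ) D → Nonempty (IsColimit c) → ¬ IsProper c) ∧
    (IsAccessibleAt K.Obj (Order.succ κ) → (∃ M : K.Obj, κ ≤ #M.str.carrier) →
      ∃ M : K.Obj, HasPresentabilityRank M (Order.succ κ)) := by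
  have hμκ : μ ≤ κ := hK.le_LS.trans hLS.le
  have hμ : μ ≤ Order.succ κ := hμκ.trans (Order.le_succ κ)
  have : Fact (Order.succ κ).IsRegular := ⟨isRegular_succ (hK.regular.aleph0_le.trans hμκ)⟩
  refine ⟨?_, ?_⟩
  · rintro I _ D c ⟨hI, hD⟩ ⟨hc⟩ hprop
    have := AbstractClass.IsMuAEC.isCardinalFiltered_of_isMuDirected hI
    obtain ⟨i, hi⟩ := hK.exists_surjective_ι hμ (Order.lt_succ κ) hc
      fun i => hK.mk_lt_of_isLTPresentable hLS hκ (hD i)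
    exact hprop i (AbstractClass.exists_section _ hi)
  · rintro ⟨_, hacc⟩ ⟨M, hM⟩
    obtain ⟨P, _, hP⟩ := hacc.exists_generator
    obtain ⟨J, _, _, ⟨p⟩⟩ := hP.exists_colimitsOfShape M
    by_contra! hno
    have hD : ∀ j, #(p.diag.obj j).str.carrier < κ := by
      intro j
      have hpres : IsPresentableAt (p.diag.obj j) (Order.succ κ) :=
        ⟨inferInstance, hP.le_isCardinalPresentable _ (p.prop_diag_obj j)⟩
      by_contra! hj
      -- An object of size at least `κ` is not presentable at any `θ ≤ κ`, so its rank would be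
      -- exactly `κ⁺`.
      refine hno _ ⟨hpres, fun θ hθ => Order.succ_le_of_lt ?_⟩
      by_contra! hle
      exact (hK.mk_lt_of_isPresentableAt hLS hκ hle hθ).not_ge hj
    obtain ⟨j, hj⟩ := hK.exists_surjective_ι hμ (Order.lt_succ κ) p.isColimit hD
    exact ((mk_le_of_surjective hj).trans_lt (hD j)).not_ge hM
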